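/- Let $\mathcal H$ be a complex Hilbert space and let $\mathcal C(\mathcal H)=\mathcal B(\mathcal H)/\mathcal K(\mathcal H)$ be its Calkin algebra (bounded operators modulo compact operators, with the quotient norm and involution). Let $p,q\in\mathcal C(\mathcal H)$ be selfadjoint projections. A geodesic joining $p$ and $q$ is a curve $\delta(t)=e^{tz}pe^{-tz}$, $t\in\mathbb R$, where $z\in\mathcal C(\mathcal H)$ satisfies $z^*=-z$ and $pzp=(1-p)z(1-p)=0$, such that $\delta(1)=q$. It is called normalized if moreover $\|z\|\le\pi/2$, and minimal if $\int_0^1\|\dot\delta(t)\|\,dt\le\int_{t_0}^{t_1}\|\dot\gamma(t)\|\,dt$ for every piecewise continuously differentiable curve $\gamma:[t_0,t_1]\to\mathcal C(\mathcal H)$ that consists of selfadjoint projections, with $\gamma(t_0)=p$ and $\gamma(t_1)=q$. Let $b=p+q$ and suppose that $b-1$ has trivial annihilator in $\mathcal C(\mathcal H)$, i.e. $(b-1)x=0$ with $x\in\mathcal C(\mathcal H)$ implies $x=0$. Then there is a unique minimal geodesic joining $p$ and $q$. This geodesic is normalized, and it is also the only normalized geodesic joining $p$ and $q$. -/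

import Mathlib

noncomputable section

/-! ### The Calkin algebra -/

/-- The adjoint of a compact operator on a Hilbert space is compact. -/
theorem isCompactOperator_star {H : Type*} [NormedAddCommGroup H] [InnerProductSpace ℂ H]
    [CompleteSpace H] {T : H →L[ℂ] H} (hT : IsCompactOperator T) :
    IsCompactOperator (star T : H →L[ℂ] H) := by
  have hc : IsCompactOperator (T * star T : H →L[ℂ] H) := hT.comp_clm (star T)
  have htb : TotallyBounded
      ((T * star T : H →L[ℂ] H) '' Metric.closedBall (0 : H) 1) :=
    (hc.isCompact_closure_image_closedBall (M₂ := H)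
      (f := ((T * star T : H →L[ℂ] H) : H →ₗ[ℂ] H)) 1).totallyBounded.subset subset_closure
  refine (isCompactOperator_iff_isCompact_closure_image_closedBall
    ((star T : H →L[ℂ] H) : H →ₗ[ℂ] H) one_pos).2 ?_
  refine TotallyBounded.isCompact_of_isClosed (TotallyBounded.closure ?_) isClosed_closure
  rw [Metric.totallyBounded_iff]
  intro ε hε
  obtain ⟨t, hts, htf, hcov⟩ := Metric.finite_approx_of_totallyBounded htb (ε ^ 2 / 2)
    (by positivity)
  obtain ⟨s, hs, hsf, rfl⟩ := Set.exists_subset_image_finite_and.1 ⟨t, hts, htf, rfl⟩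
  refine ⟨(star T : H →L[ℂ] H) '' s, hsf.image _, ?_⟩
  rintro _ ⟨x, hx, rfl⟩
  obtain ⟨_, ⟨y, hy, rfl⟩, hxy⟩ := Set.mem_iUnion₂.1 (hcov (Set.mem_image_of_mem _ hx))
  refine Set.mem_iUnion₂.2 ⟨_, Set.mem_image_of_mem _ hy, ?_⟩
  have hx1 : ‖x‖ ≤ 1 := by simpa using hx
  have hy1 : ‖y‖ ≤ 1 := by simpa using hs hy
  have hxy1 : ‖x - y‖ ≤ 2 := (norm_sub_le x y).trans (by linarith)
  have hd : ‖(T * star T : H →L[ℂ] H) (x - y)‖ < ε ^ 2 / 2 := by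
    rw [map_sub, ← dist_eq_norm]
    exact hxy
  have hsq : ‖(star T : H →L[ℂ] H) (x - y)‖ ^ 2 < ε ^ 2 := by
    calc ‖(star T : H →L[ℂ] H) (x - y)‖ ^ 2
        = RCLike.re (inner ℂ ((T * star T : H →L[ℂ] H) (x - y)) (x - y)) := by
          rw [mul_apply_eq_comp, ContinuousLinearMap.star_eq_adjoint,
            ← ContinuousLinearMap.adjoint_inner_right, ← inner_self_eq_norm_sq (𝕜 := ℂ)]
      _ ≤ ‖(T * star T : H →L[ℂ] H) (x - y)‖ * ‖x - y‖ := re_inner_le_norm _ _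
      _ ≤ ‖(T * star T : H →L[ℂ] H) (x - y)‖ * 2 := by gcongr
      _ < ε ^ 2 := by linarith
  change dist ((star T : H →L[ℂ] H) x) ((star T : H →L[ℂ] H) y) < ε
  rw [dist_eq_norm, ← map_sub]
  exact lt_of_pow_lt_pow_left₀ 2 hε.le hsq

/-- The two-sided ideal of compact operators on a Hilbert space. -/
def compactIdeal (H : Type*) [NormedAddCommGroup H] [InnerProductSpace ℂ H] [CompleteSpace H] :
    Ideal (H →L[ℂ] H) where
  carrier := {T | IsCompactOperator T}
  add_mem' := fun ha hb => IsCompactOperator.add ha hb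
  zero_mem' := isCompactOperator_zero
  smul_mem' := fun c _ hT => IsCompactOperator.clm_comp hT c

instance compactIdeal.instIsTwoSided (H : Type*) [NormedAddCommGroup H] [InnerProductSpace ℂ H]
    [CompleteSpace H] : (compactIdeal H).IsTwoSided where
  mul_mem_of_left b ha := IsCompactOperator.comp_clm ha b

instance compactIdeal.instIsClosed (H : Type*) [NormedAddCommGroup H] [InnerProductSpace ℂ H]
    [CompleteSpace H] : IsClosed (compactIdeal H : Set (H →L[ℂ] H)) :=
  isClosed_setOfPred_isCompactOperator

/-- The Calkin algebra of a complex Hilbert space: the bounded operators modulo the compact ones. -/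
def CalkinAlgebra (H : Type*) [NormedAddCommGroup H] [InnerProductSpace ℂ H] [CompleteSpace H] :
    Type _ := (H →L[ℂ] H) ⧸ compactIdeal H

namespace CalkinAlgebra

variable (H : Type*) [NormedAddCommGroup H] [InnerProductSpace ℂ H] [CompleteSpace H]

/-- The algebraic operations are those of the quotient ring. -/
instance instRing : Ring (CalkinAlgebra H) :=
  inferInstanceAs (Ring ((H →L[ℂ] H) ⧸ compactIdeal H))

/-- The quotient norm, that is `‖π(T)‖ = inf {‖T + K‖ : K compact}`. -/
instance instNormedAddCommGroup : NormedAddCommGroup (CalkinAlgebra H) :=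
  inferInstanceAs (NormedAddCommGroup ((H →L[ℂ] H) ⧸ compactIdeal H))

theorem norm_mul_le' (x y : CalkinAlgebra H) : ‖x * y‖ ≤ ‖x‖ * ‖y‖ := by
  have key : ∀ δ : ℝ, 0 < δ → ‖x * y‖ ≤ (‖x‖ + δ) * (‖y‖ + δ) := by
    intro δ hδ
    obtain ⟨S, hS, hSn⟩ := Submodule.Quotient.norm_mk_lt (S := compactIdeal H) x hδ
    obtain ⟨T, hT, hTn⟩ := Submodule.Quotient.norm_mk_lt (S := compactIdeal H) y hδ
    have hxy : x * y = (Submodule.Quotient.mk (S * T) : (H →L[ℂ] H) ⧸ compactIdeal H) := by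
      rw [← hS, ← hT]
      rfl
    rw [hxy]
    calc _ ≤ ‖S * T‖ := Submodule.Quotient.norm_mk_le (compactIdeal H) (S * T)
      _ ≤ ‖S‖ * ‖T‖ := norm_mul_le S T
      _ ≤ (‖x‖ + δ) * (‖y‖ + δ) :=
        mul_le_mul hSn.le hTn.le (norm_nonneg T) ((norm_nonneg S).trans hSn.le)
  have hlim : Filter.Tendsto (fun δ : ℝ => (‖x‖ + δ) * (‖y‖ + δ)) (nhdsWithin 0 (Set.Ioi 0))
      (nhds (‖x‖ * ‖y‖)) := by
    have hcont : Continuous (fun δ : ℝ => (‖x‖ + δ) * (‖y‖ + δ)) := by fun_prop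
    have h0 := hcont.tendsto 0
    simp only [add_zero] at h0
    exact h0.mono_left nhdsWithin_le_nhds
  exact ge_of_tendsto hlim (Filter.eventually_of_mem self_mem_nhdsWithin fun δ hδ => key δ hδ)

instance instNormedRing : NormedRing (CalkinAlgebra H) where
  toRing := instRing H
  __ := instNormedAddCommGroup H
  norm_mul_le := norm_mul_le' H

instance instAlgebra : Algebra ℂ (CalkinAlgebra H) :=
  inferInstanceAs (Algebra ℂ ((H →L[ℂ] H) ⧸ compactIdeal H))

instance instNormedAlgebra : NormedAlgebra ℂ (CalkinAlgebra H) where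
  toAlgebra := instAlgebra H
  norm_smul_le := (Submodule.Quotient.normedSpace (compactIdeal H) ℂ).norm_smul_le

instance instCompleteSpace : CompleteSpace (CalkinAlgebra H) :=
  inferInstanceAs (CompleteSpace ((H →L[ℂ] H) ⧸ compactIdeal H))

/-- The involution induced by the adjoint: `π(T)* = π(T*)`. -/
instance instStarRing : StarRing (CalkinAlgebra H) where
  star := Quotient.map' (fun T : H →L[ℂ] H => star T) (by
    intro S T h
    have h' : S - T ∈ compactIdeal H := (Submodule.quotientRel_def _).1 h
    refine (Submodule.quotientRel_def (compactIdeal H)).2 ?_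
    rw [← star_sub]
    exact isCompactOperator_star h')
  star_involutive := by
    rintro ⟨T⟩
    exact congrArg (Ideal.Quotient.mk (compactIdeal H)) (star_star T)
  star_mul := by
    rintro ⟨S⟩ ⟨T⟩
    exact congrArg (Ideal.Quotient.mk (compactIdeal H)) (star_mul S T)
  star_add := by
    rintro ⟨S⟩ ⟨T⟩
    exact congrArg (Ideal.Quotient.mk (compactIdeal H)) (star_add S T)

end CalkinAlgebra

/-! ### Curves of projections -/

section Curves

variable {A : Type*} [NormedRing A] [NormedAlgebra ℂ A] [StarRing A]

/-- `c` has trivial annihilator if `c * x = 0` implies `x = 0`. -/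
def HasTrivialAnnihilator (c : A) : Prop := ∀ x : A, c * x = 0 → x = 0

/-- The horizontal vectors at the projection `p`: the anti-Hermitian elements `z` that are
codiagonal with respect to `p`. -/
structure IsHorizontal (p z : A) : Prop where
  star_eq_neg : star z = -z
  compress : p * z * p = 0
  compress_compl : (1 - p) * z * (1 - p) = 0

/-- The geodesic `t ↦ e^{tz} p e^{-tz}` starting at `p` with horizontal exponent `z`. -/
def geodesicCurve (p z : A) (t : ℝ) : A :=
  NormedSpace.exp (t • z) * p * NormedSpace.exp (-(t • z))

/-- `δ` is a geodesic of the space of projections with `δ 0 = p` and `δ 1 = q`. -/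
def IsGeodesicJoining (p q : A) (δ : ℝ → A) : Prop :=
  ∃ z : A, IsHorizontal p z ∧ δ = geodesicCurve p z ∧ δ 1 = q

/-- `δ` is a normalized geodesic joining `p` and `q`: its exponent has norm at most `π / 2`. -/
def IsNormalizedGeodesicJoining (p q : A) (δ : ℝ → A) : Prop :=
  ∃ z : A, IsHorizontal p z ∧ ‖z‖ ≤ Real.pi / 2 ∧ δ = geodesicCurve p z ∧ δ 1 = q

/-- `γ` is continuous on `[a, b]`, and `[a, b]` splits into finitely many closed intervals
on each of which `γ` is continuously differentiable up to the end points. -/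
def IsPiecewiseC1On (γ : ℝ → A) (a b : ℝ) : Prop :=
  ∃ (n : ℕ) (t : ℕ → ℝ), Monotone t ∧ t 0 = a ∧ t n = b ∧
    ∀ i < n, ContDiffOn ℝ 1 γ (Set.Icc (t i) (t (i + 1)))

/-- The length of the curve `γ` on `[a, b]`. -/
def curveLength (γ : ℝ → A) (a b : ℝ) : ℝ := ∫ t in a..b, ‖deriv γ t‖

/-- `δ` is a minimal geodesic joining `p` and `q`: a geodesic with `δ 0 = p` and `δ 1 = q` that
is at most as long as every piecewise smooth curve of projections from `p` to `q`. -/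
def IsMinimalGeodesicJoining (p q : A) (δ : ℝ → A) : Prop :=
  IsGeodesicJoining p q δ ∧
    ∀ (γ : ℝ → A) (a b : ℝ), a < b → IsPiecewiseC1On γ a b →
      (∀ t ∈ Set.Icc a b, IsStarProjection (γ t)) → γ a = p → γ b = q →
        curveLength δ 0 1 ≤ curveLength γ a b

end Curves

end

/-! ### Compact operators and finite-codimensional subspaces -/

section Compact

/-! Put e = 2p − 1 and f = 2q − 1. A selfadjoint element of the Calkin algebra with trivial
annihilator is invertible (`isUnit_of_hasTrivialAnnihilator`), and fe + 1 = 2(p + q − 1)e. So −1 is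
not in the spectrum of the unitary fe, which therefore has exactly one logarithm ix with x
selfadjoint and ‖x‖ ≤ π. Conjugation by e inverts fe, so uniqueness forces exe = −x. Hence z = ix/2
is horizontal and e^{2z} = fe, which says that its geodesic ends at q. Every normalized geodesic
yields such a logarithm, so it is this one.

The geodesic has length ‖z‖. For the lower bound, choose a state φ with φ((f − e)²) = ‖f − e‖², that
is, Re φ(ef) = cos ‖x‖. Along a curve of symmetries e(t) from e to f, the angle arccos Re φ(e e(t))
grows at speed at most ‖e'(t)‖ (`IsState.abs_re_mul_le`): in the GNS picture, e(t) moves the cyclic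
vector along a unit sphere. So twice the length of the curve of projections is at least ‖x‖ = 2‖z‖.
Any other minimal geodesic has an exponent no longer than z, so it is normalized and the uniqueness
above applies.

The states come from the Calkin algebra itself, as limits of vector states along approximate
eigenvectors (`exists_isState_eq`). -/

theorem isCompactOperator_comp_starProjection {H : Type*} [NormedAddCommGroup H]
    [InnerProductSpace ℂ H] (T : H →L[ℂ] H) (U : Submodule ℂ H)
    [FiniteDimensional ℂ U] : IsCompactOperator (T * U.starProjection : H →L[ℂ] H) := by
  have h : IsCompactOperator (U.subtypeL ∘L U.orthogonalProjectionOnto) :=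
    (isCompactOperator_of_locallyCompactSpace_rng U.subtypeL).comp_clm U.orthogonalProjectionOnto
  exact h.clm_comp T
variable {H : Type*} [NormedAddCommGroup H] [InnerProductSpace ℂ H] [CompleteSpace H]

/-- A compact operator is small on the orthogonal complement of a finite set. -/
theorem IsCompactOperator.exists_finset_norm_le {K : H →L[ℂ] H} (hK : IsCompactOperator K)
    {ε : ℝ} (hε : 0 < ε) :
    ∃ s : Finset H, ∀ x ∈ (Submodule.span ℂ (s : Set H))ᗮ, ‖K x‖ ≤ ε * ‖x‖ := by
  have htb : TotallyBounded ((star K : H →L[ℂ] H) '' Metric.closedBall (0 : H) 1) :=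
    ((isCompactOperator_star hK).isCompact_closure_image_closedBall (M₂ := H)
      (f := ((star K : H →L[ℂ] H) : H →ₗ[ℂ] H)) 1).totallyBounded.subset subset_closure
  -- The finite set is an ε-net of the image of the unit ball under K*. If x is orthogonal to it and
  -- v is the direction of Kx, then ‖Kx‖ = |⟨K*v − y, x⟩| for a net point y close to K*v.
  obtain ⟨t, htf, hcov⟩ := Metric.totallyBounded_iff.1 htb ε hε
  refine ⟨htf.toFinset, fun x hx => ?_⟩
  rw [Set.Finite.coe_toFinset] at hx
  rcases eq_or_ne (K x) 0 with h0 | h0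
  · rw [h0, norm_zero]; positivity
  have hn : 0 < ‖K x‖ := norm_pos_iff.2 h0
  set v : H := ((‖K x‖⁻¹ : ℝ) : ℂ) • K x with hv
  have hv1 : ‖v‖ = 1 := by
    rw [hv, norm_smul, Complex.norm_real, norm_inv, norm_norm, inv_mul_cancel₀ hn.ne']
  obtain ⟨y, hy, hvy⟩ := Set.mem_iUnion₂.1 (hcov (Set.mem_image_of_mem _
    (show v ∈ Metric.closedBall (0 : H) 1 by simp [hv1])))
  have hyx : inner ℂ y x = 0 := (Submodule.mem_orthogonal _ _).1 hx y (Submodule.subset_span hy)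
  have h1 : inner ℂ v (K x) = inner ℂ ((star K : H →L[ℂ] H) v - y) x := by
    rw [inner_sub_left, hyx, sub_zero, ContinuousLinearMap.star_eq_adjoint,
      ContinuousLinearMap.adjoint_inner_left]
  have h2 : ‖inner ℂ v (K x)‖ = ‖K x‖ := by
    rw [hv, inner_smul_left, inner_self_eq_norm_sq_to_K, norm_mul]
    simp only [Complex.conj_ofReal, Complex.norm_real, norm_inv, norm_norm, Complex.coe_algebraMap,
      norm_pow]
    field_simp
  rw [← h2, h1]
  refine (norm_inner_le_norm _ _).trans ?_
  gcongr
  rw [← dist_eq_norm]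
  exact (Metric.mem_ball.1 hvy).le

end Compact

/-! ### The Calkin algebra as a C⋆-algebra. -/

namespace CalkinAlgebra

section Quotient

variable {H : Type*} [NormedAddCommGroup H] [InnerProductSpace ℂ H] [CompleteSpace H]

variable (H) in
/-- The quotient map onto the Calkin algebra. -/
def mk : (H →L[ℂ] H) →ₐ[ℂ] CalkinAlgebra H := Ideal.Quotient.mkₐ ℂ (compactIdeal H)

theorem mk_surjective : Function.Surjective (mk H) := Ideal.Quotient.mk_surjective

theorem mk_eq_zero_iff {T : H →L[ℂ] H} : mk H T = 0 ↔ IsCompactOperator T :=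
  Ideal.Quotient.eq_zero_iff_mem

theorem mk_star (T : H →L[ℂ] H) : mk H (star T) = star (mk H T) := rfl

theorem norm_mk_le (T : H →L[ℂ] H) : ‖mk H T‖ ≤ ‖T‖ :=
  Submodule.Quotient.norm_mk_le (compactIdeal H) T

theorem exists_mk_eq_norm_lt (x : CalkinAlgebra H) {ε : ℝ} (hε : 0 < ε) :
    ∃ T, mk H T = x ∧ ‖T‖ < ‖x‖ + ε :=
  Submodule.Quotient.norm_mk_lt (S := compactIdeal H) x hε

theorem exists_isSelfAdjoint_mk_eq {a : CalkinAlgebra H} (ha : IsSelfAdjoint a) :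
    ∃ T : H →L[ℂ] H, IsSelfAdjoint T ∧ mk H T = a := by
  obtain ⟨T, rfl⟩ := mk_surjective a
  refine ⟨(1 / 2 : ℂ) • (T + star T), ?_, ?_⟩
  · rw [isSelfAdjoint_iff, star_smul, star_add, star_star, add_comm]
    simp
  · rw [map_smul, map_add, mk_star, ha.star_eq, ← two_smul ℂ, smul_smul]
    norm_num

/-- Cutting T off on the finite-dimensional span changes it by a compact operator only. -/
theorem norm_mk_le_of_orthogonal (T : H →L[ℂ] H) {C : ℝ} (hC : 0 ≤ C) (s : Finset H)
    (h : ∀ x ∈ (Submodule.span ℂ (s : Set H))ᗮ, ‖T x‖ ≤ C * ‖x‖) : ‖mk H T‖ ≤ C := by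
  set U := Submodule.span ℂ (s : Set H)
  have : FiniteDimensional ℂ U := FiniteDimensional.span_finset ℂ s
  have h1 : mk H T = mk H (T - T * U.starProjection) := by
    rw [map_sub, mk_eq_zero_iff.2 (isCompactOperator_comp_starProjection T U), sub_zero]
  rw [h1]
  refine (norm_mk_le _).trans (ContinuousLinearMap.opNorm_le_bound _ hC fun x => ?_)
  have h2 : (T - T * U.starProjection) x = T (x - U.starProjection x) := by
    simp
  rw [h2]
  refine (h _ (Submodule.sub_starProjection_mem_orthogonal x)).trans ?_
  gcongr
  rw [← Submodule.starProjection_orthogonal_val]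
  exact Submodule.norm_starProjection_apply_le _ _

/-- T*T differs from a lift S of nearly minimal norm by a compact operator, which is negligible
orthogonally to a finite set. There ‖Tx‖² = ⟨T*Tx, x⟩ is bounded by nearly ‖S‖‖x‖². -/
instance instCStarRing : CStarRing (CalkinAlgebra H) where
  norm_mul_self_le x := by
    obtain ⟨T, rfl⟩ := mk_surjective x
    have key : ∀ δ : ℝ, 0 < δ → ‖mk H T‖ ^ 2 ≤ ‖star (mk H T) * mk H T‖ + 2 * δ := by
      intro δ hδ
      obtain ⟨S, hS, hSn⟩ := exists_mk_eq_norm_lt (star (mk H T) * mk H T) hδ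
      have hK : IsCompactOperator (star T * T - S : H →L[ℂ] H) := by
        rw [← mk_eq_zero_iff, map_sub, map_mul, mk_star, hS, sub_self]
      obtain ⟨s, hs⟩ := hK.exists_finset_norm_le hδ
      have hC : 0 ≤ ‖star (mk H T) * mk H T‖ + 2 * δ := by positivity
      refine (Real.le_sqrt (norm_nonneg _) hC).1 <|
        norm_mk_le_of_orthogonal T (Real.sqrt_nonneg _) s fun x hx => ?_
      refine le_of_sq_le_sq ?_ (by positivity)
      rw [mul_pow, Real.sq_sqrt hC]
      calc ‖T x‖ ^ 2 = RCLike.re (inner ℂ ((star T * T : H →L[ℂ] H) x) x) := by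
            rw [mul_apply_eq_comp, ContinuousLinearMap.star_eq_adjoint,
              ContinuousLinearMap.adjoint_inner_left, ← inner_self_eq_norm_sq (𝕜 := ℂ)]
        _ ≤ ‖(star T * T : H →L[ℂ] H) x‖ * ‖x‖ := re_inner_le_norm _ _
        _ ≤ (‖S x‖ + ‖(star T * T - S : H →L[ℂ] H) x‖) * ‖x‖ := by
            gcongr
            refine le_trans (le_of_eq ?_) (norm_add_le _ _)
            simp
        _ ≤ (‖S‖ * ‖x‖ + δ * ‖x‖) * ‖x‖ := by
            gcongr
            · exact S.le_opNorm x
            · exact hs x hx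
        _ ≤ ((‖star (mk H T) * mk H T‖ + δ) * ‖x‖ + δ * ‖x‖) * ‖x‖ := by gcongr
        _ = _ := by ring
    rw [← sq]
    refine le_of_forall_pos_le_add fun ε hε => ?_
    have := key (ε / 2) (by positivity)
    linarith

instance instStarModule : StarModule ℂ (CalkinAlgebra H) where
  star_smul c x := by
    obtain ⟨T, rfl⟩ := mk_surjective x
    rw [← map_smul, ← mk_star, star_smul, map_smul, mk_star]

noncomputable instance instCStarAlgebra : CStarAlgebra (CalkinAlgebra H) where

end Quotient

end CalkinAlgebra

/-! ### States. -/

section States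

/-- A state of a C⋆-algebra. -/
structure IsState {A : Type*} [CStarAlgebra A] (φ : A →L[ℂ] ℂ) : Prop where
  map_one : φ 1 = 1
  map_star : ∀ a, φ (star a) = star (φ a)
  norm_le : ∀ a, ‖φ a‖ ≤ ‖a‖
  nonneg : ∀ a, 0 ≤ (φ (star a * a)).re

end States

/-! ### Approximate eigenvectors, spectral states and invertibility in the Calkin algebra. -/

namespace CalkinAlgebra

section Spectrum

variable {H : Type*} [NormedAddCommGroup H] [InnerProductSpace ℂ H] [CompleteSpace H]

open Filter Topology

/-- A selfadjoint operator that is bounded below on the orthogonal complement of a finite set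
is invertible modulo the compact operators. -/
theorem isUnit_mk_of_orthogonal {T : H →L[ℂ] H} (hT : IsSelfAdjoint T) (s : Finset H) {ε : ℝ}
    (hε : 0 < ε) (h : ∀ x ∈ (Submodule.span ℂ (s : Set H))ᗮ, ε * ‖x‖ ≤ ‖T x‖) :
    IsUnit (mk H T) := by
  set U := Submodule.span ℂ (s : Set H)
  have : FiniteDimensional ℂ U := FiniteDimensional.span_finset ℂ s
  -- T² + P is coercive, since P controls x on U and T controls it on the complement. As P vanishes
  -- in the quotient, the class of T² is invertible.
  set P : H →L[ℂ] H := U.starProjection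
  have hP : mk H P = 0 := by
    have := isCompactOperator_comp_starProjection (1 : H →L[ℂ] H) U
    rwa [one_mul, ← mk_eq_zero_iff] at this
  set C : ℝ := 1 + ‖T‖ / ε + 1 / ε with hC
  have hC0 : 0 < C := by positivity
  have hbound : ∀ x, ‖x‖ ≤ C * (‖P x‖ + ‖T x‖) := by
    intro x
    have h1 := h _ (Submodule.sub_starProjection_mem_orthogonal (K := U) x)
    have h2 : ‖T (x - P x)‖ ≤ ‖T x‖ + ‖T‖ * ‖P x‖ := by
      rw [map_sub]
      exact (norm_sub_le _ _).trans (by gcongr; exact T.le_opNorm _)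
    have h3 : ‖x - P x‖ ≤ (‖T x‖ + ‖T‖ * ‖P x‖) / ε := by
      rw [le_div_iff₀ hε, mul_comm]
      exact h1.trans h2
    have h4 : ‖x‖ ≤ ‖P x‖ + ‖x - P x‖ := by
      simpa using norm_add_le (P x) (x - P x)
    calc ‖x‖ ≤ ‖P x‖ + (‖T x‖ + ‖T‖ * ‖P x‖) / ε := by linarith
      _ = (1 + ‖T‖ / ε) * ‖P x‖ + 1 / ε * ‖T x‖ := by ring
      _ ≤ C * ‖P x‖ + C * ‖T x‖ := by
        gcongr
        · rw [hC]; linarith [show 0 < 1 / ε by positivity]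
        · rw [hC]; linarith [show 0 ≤ ‖T‖ / ε by positivity]
      _ = _ := by ring
  have hinner : ∀ x, inner ℂ ((T * T + P : H →L[ℂ] H) x) x
      = ((‖T x‖ ^ 2 + ‖P x‖ ^ 2 : ℝ) : ℂ) := by
    intro x
    have hsymm : ∀ (S : H →L[ℂ] H) (hS : IsSelfAdjoint S) (y z : H),
        inner ℂ (S y) z = inner ℂ y (S z) := fun S hS y z => hS.isSymmetric y z
    have hPP : P x = P (P x) :=
      (Submodule.starProjection_eq_self_iff.2 (U.starProjection_apply_mem x)).symm
    rw [add_apply, inner_add_left, mul_apply_eq_comp, hsymm T hT, hPP,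
      hsymm P (isSelfAdjoint_starProjection U), ← hPP, inner_self_eq_norm_sq_to_K,
      inner_self_eq_norm_sq_to_K]
    simp
  have hunit : IsUnit (T * T + P : H →L[ℂ] H) := by
    -- The factor 2 comes from (a + b)² ≤ 2(a² + b²).
    refine ContinuousLinearMap.isUnit_of_forall_le_norm_inner_map _
      (c := ⟨(2 * C ^ 2)⁻¹, by positivity⟩) (by change (0 : ℝ) < _; positivity) fun x => ?_
    rw [hinner, Complex.norm_real, Real.norm_of_nonneg (by positivity)]
    change ‖x‖ ^ 2 * (2 * C ^ 2)⁻¹ ≤ _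
    rw [← div_eq_mul_inv, div_le_iff₀ (by positivity)]
    calc ‖x‖ ^ 2 ≤ (C * (‖P x‖ + ‖T x‖)) ^ 2 := by gcongr; exact hbound x
      _ ≤ _ := by nlinarith [mul_nonneg (sq_nonneg C) (sq_nonneg (‖P x‖ - ‖T x‖))]
  have := hunit.map (mk H)
  rw [map_add, hP, add_zero, map_mul, ← sq] at this
  exact (isUnit_pow_iff two_ne_zero).1 this

/-- The freedom to avoid any finite set is what makes these approximate kernel vectors visible
modulo compacts; both the states and the orthonormal sequence below are built from them. -/
theorem exists_orthogonal_norm_le {T : H →L[ℂ] H} (hT : IsSelfAdjoint T)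
    (hu : ¬ IsUnit (mk H T)) (s : Finset H) {ε : ℝ} (hε : 0 < ε) :
    ∃ x ∈ (Submodule.span ℂ (s : Set H))ᗮ, ‖x‖ = 1 ∧ ‖T x‖ ≤ ε := by
  by_contra! hcon
  refine hu (isUnit_mk_of_orthogonal hT s hε fun x hx => ?_)
  rcases eq_or_ne x 0 with rfl | h0
  · simp
  have hn : 0 < ‖x‖ := norm_pos_iff.2 h0
  have h1 := hcon (((‖x‖⁻¹ : ℝ) : ℂ) • x) (Submodule.smul_mem _ _ hx) (by
    rw [norm_smul, Complex.norm_real, norm_inv, norm_norm, inv_mul_cancel₀ hn.ne'])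
  rw [map_smul, norm_smul, Complex.norm_real, norm_inv, norm_norm, inv_mul_eq_div,
    lt_div_iff₀ hn] at h1
  exact h1.le

/-- Every spectral value of a selfadjoint element is attained by a state. -/
theorem exists_isState_eq {a : CalkinAlgebra H} (ha : IsSelfAdjoint a) {c : ℝ}
    (hc : c ∈ spectrum ℝ a) : ∃ φ : CalkinAlgebra H →L[ℂ] ℂ, IsState φ ∧ φ a = c := by
  classical
  obtain ⟨T, hT, rfl⟩ := exists_isSelfAdjoint_mk_eq ha
  set S : H →L[ℂ] H := T - (c : ℂ) • 1 with hS
  have hSsa : IsSelfAdjoint S := by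
    rw [isSelfAdjoint_iff, hS, star_sub, hT.star_eq, star_smul, star_one]
    simp
  have hSu : ¬ IsUnit (mk H S) := by
    rw [spectrum.mem_iff, IsUnit.sub_iff] at hc
    convert hc using 2
    rw [hS, map_sub, map_smul, map_one, Algebra.algebraMap_eq_smul_one]
    rfl
  -- Along the directed set of pairs (s, n), the vectors become orthogonal to every finite set while
  -- ‖Sξ‖ ≤ 1/(n + 1) tends to 0.
  choose ξ hξo hξn hξS using fun i : Finset H × ℕ =>
    exists_orthogonal_norm_le hSsa hSu i.1 (Nat.one_div_pos_of_nat (α := ℝ) (n := i.2))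
  set F : Ultrafilter (Finset H × ℕ) := Ultrafilter.of atTop
  have hF : (F : Filter (Finset H × ℕ)) ≤ atTop := Ultrafilter.of_le _
  have hbd : ∀ (R : H →L[ℂ] H) i, ‖inner ℂ (ξ i) (R (ξ i))‖ ≤ ‖R (ξ i)‖ := fun R i => by
    simpa [hξn] using norm_inner_le_norm (𝕜 := ℂ) (ξ i) (R (ξ i))
  have hbd' : ∀ (R : H →L[ℂ] H) i, ‖inner ℂ (ξ i) (R (ξ i))‖ ≤ ‖R‖ := fun R i => by
    simpa [hξn] using (hbd R i).trans (R.le_opNorm _)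
  -- Compact operators have limit zero, so the limit functional descends to the quotient.
  have hcpt : ∀ R : H →L[ℂ] H, mk H R = 0 →
      Tendsto (fun i => inner ℂ (ξ i) (R (ξ i))) F (𝓝 0) := by
    intro R hR
    refine Tendsto.mono_left (Metric.tendsto_nhds.2 fun ε hε => ?_) hF
    obtain ⟨s, hs⟩ := (mk_eq_zero_iff.1 hR).exists_finset_norm_le (half_pos hε)
    filter_upwards [eventually_ge_atTop (s, 0)] with i hi
    rw [dist_zero_right]
    have h1 := hs (ξ i) (Submodule.orthogonal_le
      (Submodule.span_mono (by exact_mod_cast hi.1)) (hξo i))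
    rw [hξn, mul_one] at h1
    exact ((hbd R i).trans h1).trans_lt (half_lt_self hε)
  have hex : ∀ x : CalkinAlgebra H, ∃ l : ℂ, ∀ R, mk H R = x →
      Tendsto (fun i => inner ℂ (ξ i) (R (ξ i))) F (𝓝 l) := by
    intro x
    obtain ⟨R, rfl⟩ := mk_surjective x
    obtain ⟨l, -, hl⟩ := (isCompact_closedBall (0 : ℂ) ‖R‖).ultrafilter_le_nhds
      (F.map fun i => inner ℂ (ξ i) (R (ξ i))) (by
        rw [le_principal_iff]
        exact Filter.mem_map.2 (Filter.univ_mem' fun i => by simpa using hbd' R i))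
    refine ⟨l, fun R' hR' => ?_⟩
    have h1 := hcpt (R' - R) (by rw [map_sub, hR', sub_self])
    have h2 : Tendsto (fun i => inner ℂ (ξ i) (R (ξ i))) F (𝓝 l) := hl
    simpa using h1.add h2
  choose f hf using hex
  have huniq : ∀ (R : H →L[ℂ] H) (l : ℂ),
      Tendsto (fun i => inner ℂ (ξ i) (R (ξ i))) F (𝓝 l) → f (mk H R) = l :=
    fun R l hl => tendsto_nhds_unique (hf _ R rfl) hl
  have hadd : ∀ x y, f (x + y) = f x + f y := by
    intro x y
    obtain ⟨R, rfl⟩ := mk_surjective x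
    obtain ⟨Q, rfl⟩ := mk_surjective y
    rw [← map_add]
    refine huniq _ _ ?_
    simpa only [add_apply, inner_add_right] using
      (hf _ R rfl).add (hf _ Q rfl)
  have hsmul : ∀ (k : ℂ) x, f (k • x) = k * f x := by
    intro k x
    obtain ⟨R, rfl⟩ := mk_surjective x
    rw [← map_smul]
    refine huniq _ _ ?_
    simpa only [smul_apply, inner_smul_right] using
      (hf _ R rfl).const_mul k
  have hnorm : ∀ x, ‖f x‖ ≤ ‖x‖ := by
    intro x
    refine le_of_forall_pos_le_add fun δ hδ => ?_
    obtain ⟨R, hR, hRn⟩ := exists_mk_eq_norm_lt x hδ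
    exact (le_of_tendsto (hf x R hR).norm (Eventually.of_forall (hbd' R))).trans hRn.le
  refine ⟨LinearMap.mkContinuous ⟨⟨f, hadd⟩, hsmul⟩ 1 fun x => by simpa using hnorm x,
    ⟨?_, ?_, hnorm, ?_⟩, ?_⟩
  · change f 1 = 1
    rw [← map_one (mk H)]
    refine huniq _ _ ?_
    simp [hξn]
  · intro x
    obtain ⟨R, rfl⟩ := mk_surjective x
    change f (star (mk H R)) = star (f (mk H R))
    rw [← mk_star]
    refine huniq _ _ ?_
    refine ((continuous_star.tendsto _).comp (hf _ R rfl)).congr fun i => ?_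
    rw [Function.comp_apply, ContinuousLinearMap.star_eq_adjoint,
      ContinuousLinearMap.adjoint_inner_right]
    exact inner_conj_symm _ _
  · intro x
    obtain ⟨R, rfl⟩ := mk_surjective x
    change 0 ≤ (f (star (mk H R) * mk H R)).re
    rw [← mk_star, ← map_mul]
    refine ge_of_tendsto ((Complex.continuous_re.tendsto _).comp (hf _ _ rfl))
      (Eventually.of_forall fun i => ?_)
    rw [Function.comp_apply, mul_apply_eq_comp, ContinuousLinearMap.star_eq_adjoint,
      ContinuousLinearMap.adjoint_inner_right]
    exact inner_self_nonneg (𝕜 := ℂ)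
  · change f (mk H T) = c
    have h0 : f (mk H S) = 0 := by
      refine huniq _ _ (squeeze_zero_norm (fun i => (hbd S i).trans (hξS i)) ?_)
      have hsnd : Tendsto (Prod.snd : Finset H × ℕ → ℕ) atTop atTop := by
        rw [← prod_atTop_atTop_eq]
        exact tendsto_snd
      exact ((tendsto_one_div_add_atTop_nhds_zero_nat (𝕜 := ℝ)).comp hsnd).mono_left hF
    have hT' : mk H T = mk H S + (c : ℂ) • mk H 1 := by
      rw [hS, map_sub, map_smul, sub_add_cancel]
    have h1 : f (mk H 1) = 1 := huniq _ _ (by simp [hξn])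
    rw [hT', hadd, hsmul, h0, h1]
    simp

/-- A selfadjoint element of the Calkin algebra with trivial annihilator is invertible. -/
theorem isUnit_of_hasTrivialAnnihilator {a : CalkinAlgebra H} (ha : IsSelfAdjoint a)
    (h : HasTrivialAnnihilator a) : IsUnit a := by
  obtain ⟨T, hT, rfl⟩ := exists_isSelfAdjoint_mk_eq ha
  by_contra hu
  -- Each vector carries its exponent; strictly increasing exponents make the n-th one at least n,
  -- whence ‖T eₙ‖ ≤ 2⁻ⁿ.
  obtain ⟨g, hg, hgr⟩ := exists_seq_of_forall_finset_exists
    (fun y : H × ℕ => ‖y.1‖ = 1 ∧ ‖T y.1‖ ≤ (1 / 2) ^ y.2)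
    (fun y y' => inner ℂ y.1 y'.1 = 0 ∧ y.2 < y'.2) (by
      intro s _
      classical
      obtain ⟨x, hx, hx1, hxT⟩ := exists_orthogonal_norm_le hT hu (s.image Prod.fst)
        (show (0 : ℝ) < (1 / 2) ^ (s.sup Prod.snd + 1) by positivity)
      refine ⟨(x, s.sup Prod.snd + 1), ⟨hx1, hxT⟩, fun y hy => ⟨?_, ?_⟩⟩
      · exact (Submodule.mem_orthogonal _ _).1 hx _
          (Submodule.subset_span (by exact_mod_cast Finset.mem_image_of_mem _ hy))
      · exact Nat.lt_succ_of_le (Finset.le_sup (f := Prod.snd) hy))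
  set e : ℕ → H := fun n => (g n).1
  have hmono : StrictMono fun n => (g n).2 := fun m n hmn => (hgr m n hmn).2
  have heT : ∀ n, ‖T (e n)‖ ≤ (1 / 2) ^ n := fun n => (hg n).2.trans
    (pow_le_pow_of_le_one (by norm_num) (by norm_num) (hmono.id_le n))
  have he : Orthonormal ℂ e := by
    refine ⟨fun n => (hg n).1, fun m n hmn => ?_⟩
    rcases lt_or_gt_of_ne hmn with h1 | h1
    · exact (hgr m n h1).1
    · exact inner_eq_zero_symm.1 (hgr n m h1).1
  set V : Submodule ℂ H := (Submodule.span ℂ (Set.range e)).topologicalClosure with hV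
  have hVc : IsClosed (V : Set H) := Submodule.isClosed_topologicalClosure _
  have : CompleteSpace V := hVc.completeSpace_coe
  have heV : ∀ n, e n ∈ V := fun n =>
    Submodule.le_topologicalClosure _ (Submodule.subset_span ⟨n, rfl⟩)
  -- The norm-convergent sum of these rank-one operators is compact and agrees with T on V. So T
  -- annihilates the projection onto V modulo compacts, which forces that projection to be compact
  -- although V is infinite-dimensional.
  set r : ℕ → (H →L[ℂ] H) := fun n => InnerProductSpace.rankOne ℂ (T (e n)) (e n)
  have hrs : Summable r := by
    refine Summable.of_norm_bounded (g := fun n : ℕ => ((1 : ℝ) / 2) ^ n)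
      (summable_geometric_of_lt_one (by norm_num) (by norm_num)) fun n => ?_
    rw [InnerProductSpace.norm_rankOne, he.1 n, mul_one]
    exact heT n
  have hrc : ∀ n, r n ∈ compactIdeal H := fun n => by
    have h1 : IsCompactOperator (ContinuousLinearMap.toSpanSingleton ℂ (T (e n))) :=
      isCompactOperator_of_locallyCompactSpace_rng _
    exact h1.comp_clm (innerSL ℂ (e n))
  have hKc : (∑' n, r n) ∈ compactIdeal H :=
    (compactIdeal.instIsClosed H).mem_of_tendsto hrs.hasSum
      (Eventually.of_forall fun s => Submodule.sum_mem _ fun n _ => hrc n)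
  have hKe : ∀ m, (∑' n, r n : H →L[ℂ] H) (e m) = T (e m) := by
    intro m
    have h1 := (hrs.hasSum.mapL (ContinuousLinearMap.apply ℂ H (e m))).tsum_eq
    change _ = (∑' n, r n : H →L[ℂ] H) (e m) at h1
    rw [← h1, tsum_eq_single m]
    · simp [r, InnerProductSpace.rankOne_apply, he.1 m]
    · intro n hn
      simp [r, InnerProductSpace.rankOne_apply, he.2 hn]
  have hKV : ∀ x ∈ V, (∑' n, r n : H →L[ℂ] H) x = T x := by
    have hle : V ≤ LinearMap.ker ((T - ∑' n, r n : H →L[ℂ] H) : H →ₗ[ℂ] H) := by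
      refine Submodule.topologicalClosure_minimal _ (Submodule.span_le.2 ?_)
        (ContinuousLinearMap.isClosed_ker _)
      rintro _ ⟨n, rfl⟩
      simp [hKe]
    intro x hx
    have := hle hx
    rw [LinearMap.mem_ker] at this
    exact (sub_eq_zero.1 this).symm
  have hTP : mk H T * mk H V.starProjection = 0 := by
    have h1 : T * V.starProjection = (∑' n, r n) * V.starProjection := by
      ext x
      exact (hKV _ (V.starProjection_apply_mem x)).symm
    rw [← map_mul, h1, mk_eq_zero_iff]
    exact IsCompactOperator.comp_clm hKc V.starProjection
  have hP : IsCompactOperator V.starProjection := mk_eq_zero_iff.1 (h _ hTP)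
  have hres := IsCompactOperator.restrict (f := (V.starProjection : H →ₗ[ℂ] H)) hP
    (V := V) (fun v _ => V.starProjection_apply_mem v) hVc
  have hid : IsCompactOperator (id : V → V) := by
    convert hres using 1
    ext v
    exact (Submodule.starProjection_eq_self_iff.2 v.2).symm
  have : FiniteDimensional ℂ V := FiniteDimensional.of_isCompactOperator_id hid
  have hli : LinearIndependent ℂ fun n => (⟨e n, heV n⟩ : V) :=
    LinearIndependent.of_comp V.subtype he.linearIndependent
  exact Set.infinite_univ.not_finite (Set.finite_univ_iff.2 hli.finite) |>.elim

end Spectrum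

end CalkinAlgebra

/-! ### Angle estimates for curves of symmetries. -/

section LowerBound

open Set Filter Topology

variable {A : Type*} [CStarAlgebra A]

namespace IsState

variable {φ : A →L[ℂ] ℂ}

theorem re_mul_comm (hφ : IsState φ) {x y : A} (hx : IsSelfAdjoint x) (hy : IsSelfAdjoint y) :
    (φ (x * y)).re = (φ (y * x)).re := by
  have h := hφ.map_star (x * y)
  rw [star_mul, hx.star_eq, hy.star_eq] at h
  rw [h]
  exact (Complex.conj_re _).symm

/-- Cauchy–Schwarz, from the discriminant of s ↦ φ((x + sy)²) ≥ 0. -/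
theorem re_mul_sq_le (hφ : IsState φ) {x y : A} (hx : IsSelfAdjoint x) (hy : IsSelfAdjoint y) :
    (φ (x * y)).re ^ 2 ≤ (φ (x * x)).re * (φ (y * y)).re := by
  have h : ∀ s : ℝ, 0 ≤ (φ (y * y)).re * (s * s) + (2 * (φ (x * y)).re) * s + (φ (x * x)).re := by
    intro s
    have h1 := hφ.nonneg (x + (s : ℂ) • y)
    have h2 : star (x + (s : ℂ) • y) = x + (s : ℂ) • y := by
      rw [star_add, star_smul, hx.star_eq, hy.star_eq]
      simp
    rw [h2, add_mul, mul_add, mul_add] at h1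
    simp only [smul_mul_assoc, mul_smul_comm, map_add, map_smul, Complex.add_re, smul_eq_mul,
      Complex.re_ofReal_mul, hφ.re_mul_comm hy hx] at h1
    linarith
  have h3 := discrim_le_zero h
  rw [discrim] at h3
  linarith

/-- If `v` is tangent to the symmetries at `e`, a state at `e₀ * v` is controlled by its value at
`e₀ * e`. -/
theorem abs_re_mul_le (hφ : IsState φ) {e₀ e v : A} (he₀ : IsSelfAdjoint e₀) (he₀2 : e₀ * e₀ = 1)
    (he : IsSelfAdjoint e) (he2 : e * e = 1) (hv : IsSelfAdjoint v) (hev : v * e + e * v = 0) :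
    |(φ (e₀ * v)).re| ≤ √(1 - (φ (e₀ * e)).re ^ 2) * ‖v‖ := by
  set f := (φ (e₀ * e)).re with hf
  have h0 : (φ (e * v)).re = 0 := by
    have h1 := congrArg (fun x => (φ x).re) hev
    simp only [map_add, map_zero, Complex.add_re, Complex.zero_re, hφ.re_mul_comm hv he] at h1
    linarith
  -- As Re φ(ev) = 0, subtracting the component of e₀ along e does not change the pairing with v,
  -- and it lowers the squared length to 1 − f².
  have hsa : IsSelfAdjoint (e₀ - (f : ℂ) • e) := by
    rw [isSelfAdjoint_iff, star_sub, star_smul, he.star_eq, he₀.star_eq]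
    simp
  have h1 := hφ.re_mul_sq_le hsa hv
  have h2 : (φ ((e₀ - (f : ℂ) • e) * v)).re = (φ (e₀ * v)).re := by
    simp [sub_mul, h0]
  have h3 : (φ ((e₀ - (f : ℂ) • e) * (e₀ - (f : ℂ) • e))).re = 1 - f ^ 2 := by
    simp only [sub_mul, mul_sub, smul_mul_assoc, mul_smul_comm, map_sub, map_smul, Complex.sub_re,
      smul_eq_mul, Complex.re_ofReal_mul, he₀2, he2, hφ.map_one, hφ.re_mul_comm he he₀, ← hf,
      Complex.one_re]
    ring
  have h4 : (φ (v * v)).re ≤ ‖v‖ ^ 2 :=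
    ((Complex.re_le_norm _).trans (hφ.norm_le _)).trans ((norm_mul_le _ _).trans_eq (sq _).symm)
  have h5 : 0 ≤ 1 - f ^ 2 := by
    have := hφ.nonneg (e₀ - (f : ℂ) • e)
    rwa [hsa.star_eq, h3] at this
  rw [h2, h3] at h1
  refine abs_le_of_sq_le_sq ?_ (by positivity)
  rw [mul_pow, Real.sq_sqrt h5]
  exact h1.trans (by gcongr)

/-- With g = Re φ(e₀ e(t)), the estimate |g'| ≤ √(1 − g²)‖e'‖ lets the angle arccos g grow by at
most the length. Keeping the comparison angle inside (0, π) keeps its sine positive. -/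
theorem cos_le_of_contDiffOn (hφ : IsState φ) {e₀ : A} (he₀ : IsSelfAdjoint e₀)
    (he₀2 : e₀ * e₀ = 1) {e : ℝ → A} {a b : ℝ} (hab : a < b)
    (hC : ContDiffOn ℝ 1 e (Icc a b)) (hsa : ∀ t ∈ Icc a b, IsSelfAdjoint (e t))
    (hsq : ∀ t ∈ Icc a b, e t * e t = 1) {θ : ℝ} (hθ : 0 < θ)
    (hθπ : θ + ∫ t in a..b, ‖derivWithin e (Icc a b) t‖ < Real.pi)
    (h0 : Real.cos θ ≤ (φ (e₀ * e a)).re) :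
    Real.cos (θ + ∫ t in a..b, ‖derivWithin e (Icc a b) t‖) ≤ (φ (e₀ * e b)).re := by
  have hud : UniqueDiffOn ℝ (Icc a b) := uniqueDiffOn_Icc hab
  have hcont : ContinuousOn (fun t => ‖derivWithin e (Icc a b) t‖) (Icc a b) :=
    (hC.continuousOn_derivWithin hud le_rfl).norm
  -- A continuous extension of the speed to ℝ, so that its primitive is differentiable everywhere.
  set w : ℝ → ℝ := IccExtend hab.le (domRestrict (Icc a b) fun t => ‖derivWithin e (Icc a b) t‖)
  have hw : Continuous w := (continuousOn_iff_continuous_domRestrict.1 hcont).Icc_extend'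
  have hweq : ∀ t ∈ Icc a b, w t = ‖derivWithin e (Icc a b) t‖ := fun t ht => by
    simp only [w, IccExtend_of_mem _ _ ht]
    rfl
  have hw0 : ∀ t, 0 ≤ w t := fun t => norm_nonneg _
  have hint : ∫ t in a..b, ‖derivWithin e (Icc a b) t‖ = ∫ t in a..b, w t :=
    intervalIntegral.integral_congr fun t ht => (hweq t (by rwa [uIcc_of_le hab.le] at ht)).symm
  rw [hint] at hθπ ⊢
  have hder : ∀ t ∈ Icc a b, HasDerivWithinAt e (derivWithin e (Icc a b) t) (Icc a b) t :=
    fun t ht => (hC.differentiableOn one_ne_zero t ht).hasDerivWithinAt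
  have hdsa : ∀ t ∈ Icc a b, IsSelfAdjoint (derivWithin e (Icc a b) t) := fun t ht =>
    (hud t ht).eq_deriv _ (((hder t ht).star).congr (fun s hs => (hsa s hs).star_eq.symm)
      (hsa t ht).star_eq.symm) (hder t ht)
  have hdac : ∀ t ∈ Icc a b,
      derivWithin e (Icc a b) t * e t + e t * derivWithin e (Icc a b) t = 0 := fun t ht =>
    (hud t ht).eq_deriv _ ((hder t ht).mul (hder t ht))
      ((hasDerivWithinAt_const t (Icc a b) (1 : A)).congr (fun s hs => hsq s hs) (hsq t ht))
  set ρ : A →L[ℝ] ℝ := Complex.reCLM ∘L φ.restrictScalars ℝ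
  have hρ : ∀ x, ρ x = (φ x).re := fun x => rfl
  set W : ℝ → ℝ := fun t => ∫ s in a..t, w s
  have hW : ∀ t, HasDerivAt W (w t) t := fun t => (hw.integral_hasStrictDerivAt a t).hasDerivAt
  have hW0 : ∀ t ∈ Icc a b, 0 ≤ W t := fun t ht =>
    intervalIntegral.integral_nonneg ht.1 fun s _ => hw0 s
  have hWb : ∀ t ∈ Icc a b, W t ≤ W b := fun t ht =>
    intervalIntegral.integral_mono_interval le_rfl ht.1 ht.2 (Eventually.of_forall hw0)
      (hw.intervalIntegrable _ _)
  -- The extra speed η provides the strict inequality of derivatives required at contact points; it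
  -- tends to 0 at the end.
  have key : ∀ η : ℝ, 0 < η → θ + W b + η * (b - a) < Real.pi →
      Real.cos (θ + W b + η * (b - a)) ≤ ρ (e₀ * e b) := by
    intro η hη hηπ
    have hmain := image_le_of_deriv_right_lt_deriv_boundary (a := a) (b := b)
      (f := fun t => -ρ (e₀ * e t)) (f' := fun t => -ρ (e₀ * derivWithin e (Icc a b) t))
      (B := fun t => -Real.cos (θ + W t + η * (t - a)))
      (B' := fun t => Real.sin (θ + W t + η * (t - a)) * (w t + η)) ?_ ?_ ?_ ?_ ?_
      (right_mem_Icc.2 hab.le)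
    · exact neg_le_neg_iff.1 hmain
    · exact (ρ.continuous.comp_continuousOn
        (continuousOn_const.mul hC.continuousOn)).neg
    · intro t ht
      have h1 : HasDerivWithinAt e (derivWithin e (Icc a b) t) (Ici t) t :=
        (hder t ⟨ht.1, ht.2.le⟩).mono_of_mem_nhdsWithin (Icc_mem_nhdsGE_of_mem ht)
      exact (ρ.hasFDerivAt.comp_hasDerivWithinAt t (h1.const_mul e₀)).neg
    · simp only [W, intervalIntegral.integral_same, sub_self, mul_zero, add_zero, hρ]
      exact neg_le_neg h0
    · intro t
      have h1 : HasDerivAt (fun t => θ + W t + η * (t - a)) (w t + η) t := by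
        simpa using ((hW t).const_add θ).fun_add (((hasDerivAt_id t).sub_const a).const_mul η)
      simpa using h1.cos.fun_neg
    · intro t ht heq
      have ht' : t ∈ Icc a b := ⟨ht.1, ht.2.le⟩
      set α := θ + W t + η * (t - a) with hα
      have hα0 : 0 < α := by
        have := mul_nonneg hη.le (sub_nonneg.2 ht.1)
        linarith [hW0 t ht']
      have hαπ : α < Real.pi := by
        have : η * (t - a) ≤ η * (b - a) := by gcongr; exact ht.2.le
        linarith [hWb t ht']
      have hsin := Real.sin_pos_of_pos_of_lt_pi hα0 hαπ
      have h1 := hφ.abs_re_mul_le he₀ he₀2 (hsa t ht') (hsq t ht') (hdsa t ht') (hdac t ht')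
      have h2 : (φ (e₀ * e t)).re = Real.cos α := neg_injective heq
      rw [h2, ← Real.abs_sin_eq_sqrt_one_sub_cos_sq, abs_of_pos hsin, ← hweq t ht'] at h1
      calc -ρ (e₀ * derivWithin e (Icc a b) t) ≤ Real.sin α * w t :=
            (neg_le_abs _).trans h1
        _ < Real.sin α * (w t + η) := by gcongr; linarith
  have hlim : Tendsto (fun η : ℝ => θ + W b + η * (b - a)) (𝓝[>] 0) (𝓝 (θ + W b)) := by
    have : Continuous fun η : ℝ => θ + W b + η * (b - a) := by fun_prop
    simpa using (this.tendsto 0).mono_left nhdsWithin_le_nhds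
  refine le_of_tendsto ((Real.continuous_cos.tendsto _).comp hlim) ?_
  filter_upwards [hlim.eventually_lt_const hθπ, self_mem_nhdsWithin] with η h1 h2
  exact key η h2 h1

end IsState

end LowerBound

/-! ### Projections, symmetries and geodesics. -/

section Geodesics

open Set Filter Topology

variable {A : Type*} [CStarAlgebra A]

theorem IsStarProjection.isSelfAdjoint_two_mul_sub_one {p : A} (hp : IsStarProjection p) :
    IsSelfAdjoint (2 * p - 1) := by
  rw [two_mul]
  exact (hp.isSelfAdjoint.add hp.isSelfAdjoint).sub (.one A)

theorem IsStarProjection.two_mul_sub_one_mul_self {p : A} (hp : IsStarProjection p) :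
    (2 * p - 1) * (2 * p - 1) = 1 := by
  have h := hp.isIdempotentElem.eq
  have h1 : (2 * p - 1) * (2 * p - 1) = 4 * (p * p) - 4 * p + 1 := by noncomm_ring
  rw [h1, h]
  noncomm_ring

/-! ### The lower bound for the length of curves of projections -/

theorem derivWithin_two_mul_sub_one {γ : ℝ → A} {s : Set ℝ} {t : ℝ}
    (hγ : DifferentiableWithinAt ℝ γ s t) (hs : UniqueDiffWithinAt ℝ s t) :
    derivWithin (fun t => 2 * γ t - 1) s t = 2 * derivWithin γ s t :=
  ((hγ.hasDerivWithinAt.const_mul 2).sub_const 1).derivWithin hs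

theorem norm_two_mul (x : A) : ‖2 * x‖ = 2 * ‖x‖ := by
  rw [two_mul, ← two_smul ℝ, norm_smul]
  norm_num

/-- `deriv` agrees with the continuous `derivWithin` in the interior; the end points, where it may
differ, do not affect integrability. -/
theorem ContDiffOn.intervalIntegrable_norm_deriv {γ : ℝ → A} {c d : ℝ} (hcd : c ≤ d)
    (hγ : ContDiffOn ℝ 1 γ (Icc c d)) :
    IntervalIntegrable (fun t => ‖deriv γ t‖) MeasureTheory.volume c d := by
  rcases hcd.eq_or_lt with rfl | hcd
  · exact IntervalIntegrable.refl
  have hcont : ContinuousOn (fun t => ‖derivWithin γ (Icc c d) t‖) (Icc c d) :=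
    (hγ.continuousOn_derivWithin (uniqueDiffOn_Icc hcd) le_rfl).norm
  refine (hcont.intervalIntegrable_of_Icc hcd.le).congr_uIoo fun t ht => ?_
  rw [uIoo_of_le hcd.le] at ht
  simp only [derivWithin_of_mem_nhds (Icc_mem_nhds ht.1 ht.2)]

/-- By induction on the pieces, the final angle bound of one piece is the initial one of the next.
The initial angle is 0, so any θ > 0 is admissible; the factor 2 is the speed of 2γ − 1 relative to
γ. -/
theorem IsState.cos_le_of_isPiecewiseC1On {φ : A →L[ℂ] ℂ} (hφ : IsState φ) {γ : ℝ → A} {a b : ℝ}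
    (hγ : IsPiecewiseC1On γ a b) (hproj : ∀ t ∈ Icc a b, IsStarProjection (γ t)) {θ : ℝ}
    (hθ : 0 < θ) (hab : a ≤ b) (hθπ : θ + 2 * curveLength γ a b < Real.pi) :
    Real.cos (θ + 2 * curveLength γ a b) ≤ (φ ((2 * γ a - 1) * (2 * γ b - 1))).re := by
  obtain ⟨n, t, ht, rfl, rfl, hC⟩ := hγ
  have hpa := hproj (t 0) (left_mem_Icc.2 hab)
  suffices H : ∀ i ≤ n, IntervalIntegrable (fun s => ‖deriv γ s‖) MeasureTheory.volume (t 0) (t i) ∧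
      (θ + 2 * curveLength γ (t 0) (t i) < Real.pi →
        Real.cos (θ + 2 * curveLength γ (t 0) (t i)) ≤
          (φ ((2 * γ (t 0) - 1) * (2 * γ (t i) - 1))).re) from (H n le_rfl).2 hθπ
  intro i
  induction i with
  | zero =>
    refine fun _ => ⟨IntervalIntegrable.refl, fun _ => ?_⟩
    rw [hpa.two_mul_sub_one_mul_self, hφ.map_one]
    exact Real.cos_le_one _
  | succ i ih =>
    intro hi
    obtain ⟨hI, hcos⟩ := ih (Nat.le_of_succ_le hi)
    have hle : t i ≤ t (i + 1) := ht (Nat.le_succ i)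
    have hCi := hC i hi
    have hI' := hCi.intervalIntegrable_norm_deriv hle
    refine ⟨hI.trans hI', ?_⟩
    have hadd : curveLength γ (t 0) (t (i + 1)) =
        curveLength γ (t 0) (t i) + curveLength γ (t i) (t (i + 1)) :=
      (intervalIntegral.integral_add_adjacent_intervals hI hI').symm
    have hpos : 0 ≤ curveLength γ (t i) (t (i + 1)) :=
      intervalIntegral.integral_nonneg hle fun _ _ => norm_nonneg _
    have hpos0 : 0 ≤ curveLength γ (t 0) (t i) :=
      intervalIntegral.integral_nonneg (ht (Nat.zero_le i)) fun _ _ => norm_nonneg _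
    intro hπ
    rcases hle.eq_or_lt with heq | hlt
    · rw [← heq] at hπ ⊢
      exact hcos hπ
    have hsub : ∀ s ∈ Icc (t i) (t (i + 1)), IsStarProjection (γ s) := fun s hs =>
      hproj s ⟨(ht (Nat.zero_le i)).trans hs.1, hs.2.trans (ht hi)⟩
    have hint : ∫ s in (t i)..(t (i + 1)),
        ‖derivWithin (fun s => 2 * γ s - 1) (Icc (t i) (t (i + 1))) s‖ =
          2 * curveLength γ (t i) (t (i + 1)) := by
      rw [curveLength, ← intervalIntegral.integral_const_mul]
      refine intervalIntegral.integral_congr_uIoo fun s hs => ?_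
      rw [uIoo_of_le hle] at hs
      have hs' := Ioo_subset_Icc_self hs
      simp only [derivWithin_two_mul_sub_one (hCi.differentiableOn one_ne_zero s hs')
        (uniqueDiffOn_Icc hlt s hs'), norm_two_mul,
        derivWithin_of_mem_nhds (Icc_mem_nhds hs.1 hs.2)]
    have hmain := hφ.cos_le_of_contDiffOn hpa.isSelfAdjoint_two_mul_sub_one
      hpa.two_mul_sub_one_mul_self hlt (e := fun s => 2 * γ s - 1)
      ((contDiffOn_const.mul hCi).sub contDiffOn_const)
      (fun s hs => (hsub s hs).isSelfAdjoint_two_mul_sub_one)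
      (fun s hs => (hsub s hs).two_mul_sub_one_mul_self)
      (θ := θ + 2 * curveLength γ (t 0) (t i)) (by linarith)
      (by rw [hint]; linarith) (hcos (by linarith))
    rw [hint] at hmain
    rwa [hadd, mul_add, ← add_assoc]

/-! ### Geodesics -/

theorem exp_mul_exp_neg (x : A) : NormedSpace.exp x * NormedSpace.exp (-x) = 1 := by
  let _ : NormedAlgebra ℚ A := NormedAlgebra.restrictScalars ℚ ℂ A
  rw [← NormedSpace.exp_add_of_commute (Commute.refl x).neg_right, add_neg_cancel,
    NormedSpace.exp_zero]

theorem exp_mul_exp_self (x : A) :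
    NormedSpace.exp x * NormedSpace.exp x = NormedSpace.exp (2 * x) := by
  let _ : NormedAlgebra ℚ A := NormedAlgebra.restrictScalars ℚ ℂ A
  rw [← NormedSpace.exp_add_of_commute (Commute.refl x), two_mul]

theorem exp_conj_of_mul_self_eq_one {e : A} (he : e * e = 1) (x : A) :
    NormedSpace.exp (e * x * e) = e * NormedSpace.exp x * e := by
  let _ : NormedAlgebra ℚ A := NormedAlgebra.restrictScalars ℚ ℂ A
  exact NormedSpace.exp_units_conj ⟨e, e, he, he⟩ x

theorem exp_mem_unitary_of_star_eq_neg {z : A} (hz : star z = -z) :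
    NormedSpace.exp z ∈ unitary A := by
  let _ : NormedAlgebra ℚ A := NormedAlgebra.restrictScalars ℚ ℂ A
  exact NormedSpace.exp_mem_unitary_of_mem_skewAdjoint (skewAdjoint.mem_iff.2 hz)

theorem star_exp_of_star_eq_neg {z : A} (hz : star z = -z) :
    star (NormedSpace.exp z) = NormedSpace.exp (-z) := by
  let _ : NormedAlgebra ℚ A := NormedAlgebra.restrictScalars ℚ ℂ A
  rw [NormedSpace.star_exp, hz]

theorem star_real_smul_eq_neg {z : A} (hz : star z = -z) (t : ℝ) : star (t • z) = -(t • z) := by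
  rw [star_smul, hz, star_trivial, smul_neg]

/-- Conjugation by 2p − 1 fixes the diagonal part of z and negates the codiagonal part. This form
passes through the exponential. -/
theorem isHorizontal_iff {p z : A} (hp : IsIdempotentElem p) :
    IsHorizontal p z ↔ star z = -z ∧ (2 * p - 1) * z * (2 * p - 1) = -z := by
  have hpp := hp.eq
  have expand : (2 * p - 1) * z * (2 * p - 1) = 4 * (p * z * p) - 2 * (p * z) - 2 * (z * p) + z := by
    noncomm_ring
  constructor
  · rintro ⟨h1, h2, h3⟩
    refine ⟨h1, ?_⟩
    have h4 : (1 - p) * z * (1 - p) = z - p * z - z * p + p * z * p := by noncomm_ring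
    rw [h4, h2, add_zero] at h3
    have h5 : z = p * z + z * p := by
      rw [sub_sub, sub_eq_zero] at h3
      exact h3
    rw [expand, h2]
    have h6 : (4 : A) * 0 - 2 * (p * z) - 2 * (z * p) + z = -2 * (p * z + z * p) + z := by
      noncomm_ring
    rw [h6, ← h5]
    noncomm_ring
  · rintro ⟨h1, h2⟩
    have h3 : p * z + z * p = 2 * (p * z * p) + z := by
      have : (2 : ℂ) • (p * z + z * p) = (2 : ℂ) • (2 * (p * z * p) + z) := by
        rw [expand] at h2
        simp only [two_smul]
        have h4 : 4 * (p * z * p) - 2 * (p * z) - 2 * (z * p) + z + z = 0 := by rw [h2]; simp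
        have h5 : p * z + z * p + (p * z + z * p) =
          (2 * (p * z * p) + z + (2 * (p * z * p) + z)) -
            (4 * (p * z * p) - 2 * (p * z) - 2 * (z * p) + z + z) := by noncomm_ring
        rw [h5, h4, sub_zero]
      exact smul_right_injective A (two_ne_zero (α := ℂ)) this
    have h4 : p * z * p = 0 := by
      have h5 : p * (p * z + z * p) * p = p * (2 * (p * z * p) + z) * p := by rw [h3]
      have h6 : p * (p * z + z * p) * p = p * p * z * p + p * z * (p * p) := by noncomm_ring
      have h7 : p * (2 * (p * z * p) + z) * p = 2 * ((p * p) * z * (p * p)) + p * z * p := by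
        noncomm_ring
      rw [h6, h7, hpp, two_mul] at h5
      simpa using h5
    refine ⟨h1, h4, ?_⟩
    have h5 : (1 - p) * z * (1 - p) = z - (p * z + z * p) + p * z * p := by noncomm_ring
    rw [h5, h3, h4]
    simp

namespace IsHorizontal

variable {p z : A}

theorem mul_exp_neg (hp : IsStarProjection p) (hz : IsHorizontal p z) (t : ℝ) :
    (2 * p - 1) * NormedSpace.exp (-(t • z)) = NormedSpace.exp (t • z) * (2 * p - 1) := by
  have h1 : (2 * p - 1) * (t • z) * (2 * p - 1) = -(t • z) := by
    rw [mul_smul_comm, smul_mul_assoc, ((isHorizontal_iff hp.isIdempotentElem).1 hz).2, smul_neg]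
  rw [← h1, exp_conj_of_mul_self_eq_one hp.two_mul_sub_one_mul_self, mul_assoc, ← mul_assoc,
    hp.two_mul_sub_one_mul_self, one_mul]

/-- Moving the symmetry across e^{−tz} inverts that factor, so the two exponentials merge. -/
theorem two_mul_geodesicCurve_sub_one (hp : IsStarProjection p) (hz : IsHorizontal p z) (t : ℝ) :
    2 * geodesicCurve p z t - 1 = NormedSpace.exp (t • (2 * z)) * (2 * p - 1) := by
  have h1 : 2 * geodesicCurve p z t - 1 =
      NormedSpace.exp (t • z) * ((2 * p - 1) * NormedSpace.exp (-(t • z))) := by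
    have h2 : NormedSpace.exp (t • z) * ((2 * p - 1) * NormedSpace.exp (-(t • z))) =
        2 * geodesicCurve p z t - NormedSpace.exp (t • z) * NormedSpace.exp (-(t • z)) := by
      rw [geodesicCurve]
      noncomm_ring
    rw [h2, exp_mul_exp_neg]
  rw [h1, hz.mul_exp_neg hp, ← mul_assoc, exp_mul_exp_self, mul_smul_comm]

theorem geodesicCurve_zero : geodesicCurve p z 0 = p := by
  simp [geodesicCurve, NormedSpace.exp_zero]

theorem isStarProjection_geodesicCurve (hp : IsStarProjection p) (hz : IsHorizontal p z) (t : ℝ) :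
    IsStarProjection (geodesicCurve p z t) := by
  have hs := star_real_smul_eq_neg hz.star_eq_neg t
  have h1 : NormedSpace.exp (-(t • z)) * NormedSpace.exp (t • z) = 1 := by
    simpa using exp_mul_exp_neg (-(t • z))
  constructor
  · rw [IsIdempotentElem, geodesicCurve]
    calc _ = NormedSpace.exp (t • z) * p * (NormedSpace.exp (-(t • z)) * NormedSpace.exp (t • z)) *
          p * NormedSpace.exp (-(t • z)) := by simp only [mul_assoc]
      _ = _ := by rw [h1, mul_one, mul_assoc _ p p, hp.isIdempotentElem.eq]
  · rw [isSelfAdjoint_iff, geodesicCurve, star_mul, star_mul, hp.isSelfAdjoint.star_eq,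
      star_exp_of_star_eq_neg hs, ← star_exp_of_star_eq_neg hs, star_star, mul_assoc]

theorem hasDerivAt_geodesicCurve (hp : IsStarProjection p) (hz : IsHorizontal p z) (t : ℝ) :
    HasDerivAt (geodesicCurve p z) (NormedSpace.exp (t • (2 * z)) * (z * (2 * p - 1))) t := by
  have h1 : geodesicCurve p z = fun t : ℝ =>
      (1 / 2 : ℝ) • (NormedSpace.exp (t • (2 * z)) * (2 * p - 1) + 1) := by
    funext s
    rw [← hz.two_mul_geodesicCurve_sub_one hp, sub_add_cancel, two_mul, ← two_smul ℝ, smul_smul]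
    norm_num
  rw [h1]
  refine ((((hasDerivAt_exp_smul_const (𝕂 := ℝ) (2 * z) t).mul_const
    (2 * p - 1)).add_const 1).const_smul (1 / 2 : ℝ)).congr_deriv ?_
  rw [two_mul z, ← two_smul ℝ z, mul_smul_comm, smul_mul_assoc, smul_smul, mul_assoc]
  norm_num

/-- The velocity is z multiplied by a unitary on either side. -/
theorem norm_deriv_geodesicCurve (hp : IsStarProjection p) (hz : IsHorizontal p z) (t : ℝ) :
    ‖deriv (geodesicCurve p z) t‖ = ‖z‖ := by
  have hs : star (t • (2 * z)) = -(t • (2 * z)) := by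
    refine star_real_smul_eq_neg ?_ t
    rw [two_mul, star_add, hz.star_eq_neg, neg_add]
  rw [(hz.hasDerivAt_geodesicCurve hp t).deriv,
    CStarRing.norm_mem_unitary_mul _ (exp_mem_unitary_of_star_eq_neg hs),
    CStarRing.norm_mul_mem_unitary _ hp.two_mul_sub_one_mem_unitary]

theorem curveLength_geodesicCurve (hp : IsStarProjection p) (hz : IsHorizontal p z) :
    curveLength (geodesicCurve p z) 0 1 = ‖z‖ := by
  simp [curveLength, hz.norm_deriv_geodesicCurve hp]

theorem isPiecewiseC1On_geodesicCurve (hp : IsStarProjection p) (hz : IsHorizontal p z) :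
    IsPiecewiseC1On (geodesicCurve p z) 0 1 := by
  have hC : ContDiff ℝ 1 (geodesicCurve p z) := by
    rw [contDiff_one_iff_deriv]
    refine ⟨fun t => (hz.hasDerivAt_geodesicCurve hp t).differentiableAt, ?_⟩
    have h1 : deriv (geodesicCurve p z) =
        fun t : ℝ => NormedSpace.exp (t • (2 * z)) * (z * (2 * p - 1)) :=
      funext fun t => (hz.hasDerivAt_geodesicCurve hp t).deriv
    rw [h1]
    refine Continuous.mul (continuous_iff_continuousAt.2 fun t => ?_) continuous_const
    exact (hasDerivAt_exp_smul_const (𝕂 := ℝ) (2 * z) t).continuousAt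
  exact ⟨1, fun i => i, Nat.mono_cast, by simp, by simp, fun i _ => hC.contDiffOn⟩

theorem geodesicCurve_one_eq_iff (hp : IsStarProjection p) (hz : IsHorizontal p z) {q : A} :
    geodesicCurve p z 1 = q ↔ NormedSpace.exp (2 * z) = (2 * q - 1) * (2 * p - 1) := by
  have h := hz.two_mul_geodesicCurve_sub_one hp 1
  rw [one_smul] at h
  constructor
  · rintro rfl
    rw [h, mul_assoc, hp.two_mul_sub_one_mul_self, mul_one]
  · intro h1
    rw [h1, mul_assoc, hp.two_mul_sub_one_mul_self, mul_one, sub_left_inj, two_mul, two_mul,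
      ← two_smul ℂ, ← two_smul ℂ] at h
    exact smul_right_injective A (two_ne_zero (α := ℂ)) h

end IsHorizontal

end Geodesics

/-! ### Logarithms of the product of symmetries, minimality and uniqueness. -/

section Minimality

open Set Filter Topology Unitary selfAdjoint

variable {A : Type*} [CStarAlgebra A]

/-- By the chord formula ‖u − 1‖² = 2(1 − cos ‖x‖), the value ‖x‖ = π would give ‖u − 1‖ = 2. -/
theorem norm_argSelfAdjoint_lt_pi {u : unitary A} (hu : ‖(u - 1 : A)‖ < 2) :
    ‖argSelfAdjoint u‖ < Real.pi := by
  refine lt_of_le_of_ne (norm_argSelfAdjoint_le_pi u) fun h => ?_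
  have h1 := two_mul_one_sub_cos_norm_argSelfAdjoint hu
  rw [h, Real.cos_pi] at h1
  nlinarith [norm_nonneg (u - 1 : A)]

/-- An element of norm at most `π` is determined by its unitary exponential, if that exponential
does not have `-1` in its spectrum. -/
theorem eq_argSelfAdjoint_of_norm_le_pi {x : selfAdjoint A} (hx : ‖x‖ ≤ Real.pi)
    (hu : ‖(expUnitary x - 1 : A)‖ < 2) : x = argSelfAdjoint (expUnitary x) := by
  refine (argSelfAdjoint_expUnitary (lt_of_le_of_ne hx fun h => ?_)).symm
  have h1 := norm_sq_expUnitary_sub_one hx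
  rw [h, Real.cos_pi] at h1
  nlinarith [norm_nonneg (expUnitary x - 1 : A)]

section Pair

variable {p q : A}

/-- The product of the symmetries of two projections. -/
def symmetryProduct (hp : IsStarProjection p) (hq : IsStarProjection q) : unitary A :=
  ⟨(2 * q - 1) * (2 * p - 1),
    mul_mem hq.two_mul_sub_one_mem_unitary hp.two_mul_sub_one_mem_unitary⟩

/-- Distance less than 2 from 1 means that −1 is not in the spectrum, and (2q − 1)(2p − 1) + 1 = 2(p
+ q − 1)(2p − 1) is invertible. -/
theorem norm_symmetryProduct_sub_one_lt (hp : IsStarProjection p) (hq : IsStarProjection q)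
    (hu : IsUnit (p + q - 1)) : ‖(symmetryProduct hp hq - 1 : A)‖ < 2 := by
  rw [norm_sub_one_lt_two_iff (symmetryProduct hp hq).2, spectrum.mem_iff, not_not]
  have h2 : IsUnit (2 : A) := by
    rw [← map_ofNat (algebraMap ℂ A) 2]
    exact (isUnit_iff_ne_zero.2 two_ne_zero).map (algebraMap ℂ A)
  have he : IsUnit (2 * p - 1) :=
    ⟨⟨_, _, hp.two_mul_sub_one_mul_self, hp.two_mul_sub_one_mul_self⟩, rfl⟩
  have h3 : algebraMap ℂ A (-1) - (symmetryProduct hp hq : A) =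
      -(2 * (p + q - 1) * (2 * p - 1)) := by
    have h4 : 2 * (p + q - 1) * (2 * p - 1) =
        (2 * q - 1) * (2 * p - 1) + (2 * p - 1) * (2 * p - 1) := by noncomm_ring
    rw [h4, hp.two_mul_sub_one_mul_self, map_neg, map_one, neg_add, symmetryProduct]
    exact (neg_add_eq_sub _ _).symm.trans (by abel)
  rw [h3]
  exact ((h2.mul hu).mul he).neg

/-- The bound π/2 on z is the bound π on the selfadjoint logarithm −2iz, which is the range where
logarithms are unique. -/
theorem IsHorizontal.eq_argSelfAdjoint (hp : IsStarProjection p) (hq : IsStarProjection q)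
    (hu : IsUnit (p + q - 1)) {z : A} (hz : IsHorizontal p z) (hzn : ‖z‖ ≤ Real.pi / 2)
    (hzq : geodesicCurve p z 1 = q) :
    z = (Complex.I / 2) • (argSelfAdjoint (symmetryProduct hp hq) : A) := by
  have hsa : IsSelfAdjoint ((-2 * Complex.I) • z) := by
    rw [isSelfAdjoint_iff, star_smul, hz.star_eq_neg, smul_neg, ← neg_smul]
    congr 1
    simp
  set x : selfAdjoint A := ⟨(-2 * Complex.I) • z, hsa⟩ with hxdef
  have hexp : expUnitary x = symmetryProduct hp hq := by
    ext
    rw [expUnitary_coe]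
    refine Eq.trans ?_ ((hz.geodesicCurve_one_eq_iff hp).1 hzq)
    rw [two_mul, ← two_smul ℂ, hxdef, smul_smul]
    congr 2
    linear_combination (-2 : ℂ) * Complex.I_mul_I
  have hxn : ‖x‖ ≤ Real.pi := by
    change ‖(-2 * Complex.I) • z‖ ≤ Real.pi
    rw [norm_smul]
    simp only [norm_mul, norm_neg, Complex.norm_I, Complex.norm_ofNat, mul_one]
    linarith
  have hlt := norm_symmetryProduct_sub_one_lt hp hq hu
  rw [← hexp] at hlt
  have hx := eq_argSelfAdjoint_of_norm_le_pi hxn hlt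
  rw [hexp] at hx
  rw [← hx, hxdef, smul_smul]
  have : Complex.I / 2 * (-2 * Complex.I) = 1 := by linear_combination -Complex.I_mul_I
  rw [this, one_smul]

/-- The codiagonal logarithm: projections whose sum minus one is invertible are joined by a
geodesic with exponent of norm less than `π / 2`. -/
theorem isHorizontal_argSelfAdjoint (hp : IsStarProjection p) (hq : IsStarProjection q)
    (hu : IsUnit (p + q - 1)) :
    IsHorizontal p ((Complex.I / 2) • (argSelfAdjoint (symmetryProduct hp hq) : A)) ∧
      geodesicCurve p ((Complex.I / 2) • (argSelfAdjoint (symmetryProduct hp hq) : A)) 1 = q := by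
  have hlt := norm_symmetryProduct_sub_one_lt hp hq hu
  set x := argSelfAdjoint (symmetryProduct hp hq) with hx
  set e : A := 2 * p - 1 with he
  have hesa : IsSelfAdjoint e := hp.isSelfAdjoint_two_mul_sub_one
  have hee : e * e = 1 := hp.two_mul_sub_one_mul_self
  have heu : e ∈ unitary A := hp.two_mul_sub_one_mem_unitary
  have hexp : NormedSpace.exp (Complex.I • (x : A)) = (2 * q - 1) * e := by
    rw [← expUnitary_coe, hx, expUnitary_argSelfAdjoint hlt]
    rfl
  have hstar : star (Complex.I • (x : A)) = -(Complex.I • (x : A)) := by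
    rw [star_smul, x.2.star_eq]
    simp
  -- Since e(fe)*e = fe, the element −exe is a second logarithm of the same unitary with norm at
  -- most π, hence equals x.
  have hysa : IsSelfAdjoint (-(e * x * e)) := by
    rw [isSelfAdjoint_iff, star_neg, star_mul, star_mul, hesa.star_eq, x.2.star_eq, mul_assoc]
  set y : selfAdjoint A := ⟨-(e * x * e), hysa⟩ with hy
  have hyn : ‖y‖ ≤ Real.pi := by
    change ‖-(e * (x : A) * e)‖ ≤ Real.pi
    rw [norm_neg, CStarRing.norm_mul_mem_unitary _ heu,
      CStarRing.norm_mem_unitary_mul _ heu]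
    exact norm_argSelfAdjoint_le_pi _
  have hyexp : expUnitary y = symmetryProduct hp hq := by
    ext
    have h1 : Complex.I • (-(e * x * e)) = e * (-(Complex.I • (x : A))) * e := by
      simp only [smul_neg, mul_neg, neg_mul, mul_smul_comm, smul_mul_assoc]
    rw [expUnitary_coe, hy, h1, exp_conj_of_mul_self_eq_one hee, ← star_exp_of_star_eq_neg hstar,
      hexp, star_mul, hesa.star_eq, hq.isSelfAdjoint_two_mul_sub_one.star_eq, ← mul_assoc, hee,
      one_mul]
    rfl
  have hyx : y = x := by
    rw [eq_argSelfAdjoint_of_norm_le_pi hyn (by rwa [hyexp]), hyexp]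
  have hexe : e * x * e = -(x : A) := neg_eq_iff_eq_neg.1 (congrArg Subtype.val hyx)
  have hhor : IsHorizontal p ((Complex.I / 2) • (x : A)) := by
    refine (isHorizontal_iff hp.isIdempotentElem).2 ⟨?_, ?_⟩
    · rw [star_smul, x.2.star_eq, ← neg_smul]
      congr 1
      simp [neg_div]
    · rw [← he, mul_smul_comm, smul_mul_assoc, hexe, smul_neg]
  refine ⟨hhor, (hhor.geodesicCurve_one_eq_iff hp).2 ?_⟩
  rw [← hexp, two_mul, ← two_smul ℂ, smul_smul, mul_div_cancel₀ _ two_ne_zero]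

/-- A state attaining ‖f − e‖² sees the full angle ‖x‖ between e and f, so no curve can cover it
with less length. -/
theorem norm_argSelfAdjoint_le_two_mul_curveLength
    (hstate : ∀ a : A, IsSelfAdjoint a → ∀ c ∈ spectrum ℝ a, ∃ φ : A →L[ℂ] ℂ, IsState φ ∧ φ a = c)
    (hp : IsStarProjection p) (hq : IsStarProjection q) (hu : IsUnit (p + q - 1))
    {γ : ℝ → A} {a b : ℝ} (hab : a < b) (hγ : IsPiecewiseC1On γ a b)
    (hproj : ∀ t ∈ Icc a b, IsStarProjection (γ t)) (hγa : γ a = p) (hγb : γ b = q) :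
    ‖argSelfAdjoint (symmetryProduct hp hq)‖ ≤ 2 * curveLength γ a b := by
  have hL : 0 ≤ curveLength γ a b := intervalIntegral.integral_nonneg hab.le
    fun _ _ => norm_nonneg _
  obtain _ | _ := subsingleton_or_nontrivial A
  · rw [Subsingleton.elim (argSelfAdjoint (symmetryProduct hp hq)) 0, norm_zero]
    positivity
  have hlt := norm_symmetryProduct_sub_one_lt hp hq hu
  set x := argSelfAdjoint (symmetryProduct hp hq) with hx
  have hxπ : ‖x‖ < Real.pi := norm_argSelfAdjoint_lt_pi hlt
  have hcos := two_mul_one_sub_cos_norm_argSelfAdjoint hlt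
  set e := 2 * p - 1 with he
  set f := 2 * q - 1 with hf
  have hesa : IsSelfAdjoint e := hp.isSelfAdjoint_two_mul_sub_one
  have hfsa : IsSelfAdjoint f := hq.isSelfAdjoint_two_mul_sub_one
  have hee : e * e = 1 := hp.two_mul_sub_one_mul_self
  have hff : f * f = 1 := hq.two_mul_sub_one_mul_self
  have hnorm : ‖(symmetryProduct hp hq - 1 : A)‖ = ‖f - e‖ := by
    have h1 : (symmetryProduct hp hq - 1 : A) = (f - e) * e := by
      rw [sub_mul, hee]
      rfl
    rw [h1, CStarRing.norm_mul_mem_unitary _ hp.two_mul_sub_one_mem_unitary]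
  obtain ⟨φ, hφ, hφd⟩ : ∃ φ : A →L[ℂ] ℂ, IsState φ ∧
      (φ (star (f - e) * (f - e))).re = ‖f - e‖ ^ 2 := by
    have h1 : ‖star (f - e) * (f - e)‖ = ‖f - e‖ ^ 2 := by
      rw [CStarRing.norm_star_mul_self, sq]
    have hsa : IsSelfAdjoint (star (f - e) * (f - e)) := .star_mul_self _
    rcases CStarAlgebra.norm_or_neg_norm_mem_spectrum hsa with h | h
    · obtain ⟨φ, hφ, h2⟩ := hstate _ hsa _ h
      exact ⟨φ, hφ, by rw [h2, Complex.ofReal_re, h1]⟩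
    -- Positivity of φ leaves only the value 0 here.
    · obtain ⟨φ, hφ, h2⟩ := hstate _ hsa _ h
      refine ⟨φ, hφ, ?_⟩
      have h3 := hφ.nonneg (f - e)
      rw [h2, Complex.ofReal_re, h1] at h3 ⊢
      linarith [sq_nonneg ‖f - e‖]
  have hφef : (φ (e * f)).re = Real.cos ‖x‖ := by
    have h1 : star (f - e) * (f - e) = f * f + e * e - e * f - f * e := by
      rw [(hfsa.sub hesa).star_eq]
      noncomm_ring
    rw [h1, hee, hff, map_sub, map_sub, map_add, hφ.map_one, Complex.sub_re, Complex.sub_re,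
      Complex.add_re, Complex.one_re, hφ.re_mul_comm hfsa hesa, ← hnorm, ← hcos] at hφd
    linarith
  by_contra! hcon
  -- Half of the gap: positive, and θ plus twice the length is still below ‖x‖.
  set θ := (‖x‖ - 2 * curveLength γ a b) / 2 with hθ
  have h1 := hφ.cos_le_of_isPiecewiseC1On hγ hproj (θ := θ) (by rw [hθ]; linarith) hab.le
    (by rw [hθ]; linarith)
  rw [hγa, hγb, hφef] at h1
  exact absurd h1 (not_le.2 (Real.cos_lt_cos_of_nonneg_of_le_pi (by rw [hθ]; linarith) hxπ.le
    (by rw [hθ]; linarith)))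

/-- In a C⋆-algebra in which the spectral values of selfadjoint elements are attained by states,
two projections whose sum minus one is invertible are joined by a unique minimal geodesic, which
is the only normalized geodesic. -/
theorem exists_unique_minimal_geodesic
    (hstate : ∀ a : A, IsSelfAdjoint a → ∀ c ∈ spectrum ℝ a, ∃ φ : A →L[ℂ] ℂ, IsState φ ∧ φ a = c)
    (hp : IsStarProjection p) (hq : IsStarProjection q) (hu : IsUnit (p + q - 1)) :
    ∃ δ : ℝ → A, IsMinimalGeodesicJoining p q δ ∧ IsNormalizedGeodesicJoining p q δ ∧
      ∀ δ' : ℝ → A,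
        IsMinimalGeodesicJoining p q δ' ∨ IsNormalizedGeodesicJoining p q δ' → δ' = δ := by
  obtain ⟨hz, hzq⟩ := isHorizontal_argSelfAdjoint hp hq hu
  set z : A := (Complex.I / 2) • (argSelfAdjoint (symmetryProduct hp hq) : A) with hzdef
  have hzn : ‖z‖ = ‖argSelfAdjoint (symmetryProduct hp hq)‖ / 2 := by
    change _ = ‖(argSelfAdjoint (symmetryProduct hp hq) : A)‖ / 2
    rw [hzdef, norm_smul, norm_div, Complex.norm_I, Complex.norm_ofNat]
    ring
  have hzπ : ‖z‖ ≤ Real.pi / 2 := by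
    rw [hzn]
    linarith [norm_argSelfAdjoint_le_pi (symmetryProduct hp hq)]
  have hnormalized : ∀ δ', IsNormalizedGeodesicJoining p q δ' → δ' = geodesicCurve p z := by
    rintro δ' ⟨z', hz', hz'n, rfl, hz'q⟩
    rw [hz'.eq_argSelfAdjoint hp hq hu hz'n hz'q]
  refine ⟨geodesicCurve p z, ⟨⟨z, hz, rfl, hzq⟩, ?_⟩, ⟨z, hz, hzπ, rfl, hzq⟩, ?_⟩
  · intro γ a b hab hγ hproj hγa hγb
    rw [hz.curveLength_geodesicCurve hp, hzn]
    linarith [norm_argSelfAdjoint_le_two_mul_curveLength hstate hp hq hu hab hγ hproj hγa hγb]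
  · rintro δ' (⟨⟨z', hz', rfl, hz'q⟩, hmin⟩ | hδ')
    -- Testing minimality against the constructed geodesic gives ‖z'‖ ≤ ‖z‖ ≤ π/2.
    · have h1 := hmin (geodesicCurve p z) 0 1 one_pos (hz.isPiecewiseC1On_geodesicCurve hp)
        (fun t _ => hz.isStarProjection_geodesicCurve hp t) IsHorizontal.geodesicCurve_zero hzq
      rw [hz.curveLength_geodesicCurve hp, hz'.curveLength_geodesicCurve hp] at h1
      exact hnormalized _ ⟨z', hz', h1.trans hzπ, rfl, hz'q⟩
    · exact hnormalized _ hδ'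

end Pair

end Minimality

theorem mainTheorem2 {H : Type*} [NormedAddCommGroup H] [InnerProductSpace ℂ H] [CompleteSpace H]
    (p q : CalkinAlgebra H) (hp : IsStarProjection p) (hq : IsStarProjection q)
    (hb : HasTrivialAnnihilator (p + q - 1)) :
    ∃ δ : ℝ → CalkinAlgebra H,
      IsMinimalGeodesicJoining p q δ ∧ IsNormalizedGeodesicJoining p q δ ∧
        ∀ δ' : ℝ → CalkinAlgebra H,
          IsMinimalGeodesicJoining p q δ' ∨ IsNormalizedGeodesicJoining p q δ' → δ' = δ := by
  have hsa : IsSelfAdjoint (p + q - 1) :=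
    (hp.isSelfAdjoint.add hq.isSelfAdjoint).sub (.one (CalkinAlgebra H))
  exact exists_unique_minimal_geodesic (fun a ha c hc => CalkinAlgebra.exists_isState_eq ha hc)
    hp hq (CalkinAlgebra.isUnit_of_hasTrivialAnnihilator hsa hb)
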